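/- Let $V$ be a complex vector space of dimension $N+1$, and let $\mathbb{P}(V)$ be the projective space of lines through $0$ in $V$. (If $V=(\mathbb{C}^{N+1})^\vee$, then $\mathbb{P}(V)$ is the dual projective space $(\mathbb{P}^N)^\vee$.) Let $\mathcal{T}\subset \mathbb{P}(V)\times V$ be the tautological line bundle, whose fibre at a point is the line in $V$ represented by that point, and let $$\mathcal{Q}:=\frac{\mathbb{P}(V)\times V}{\mathcal{T}}$$ be the quotient bundle, a holomorphic vector bundle of rank $N$ on $\mathbb{P}(V)$. Let $\mathbb{L}\subset\mathbb{P}(V)$ be a line, that is, $\mathbb{L}=\mathbb{P}(W)$ for some $2$-dimensional linear subspace $W\subseteq V$ (so that $N\ge 1$), let $\mathcal{O}_{\mathbb{L}}$ be the trivial line bundle on $\mathbb{L}$, and let $\mathcal{O}_{\mathbb{L}}(1)$ be the dual of the tautological line bundle of $\mathbb{L}=\mathbb{P}(W)$. Then the restriction $\mathcal{Q}_{\mathbb{L}}$ of $\mathcal{Q}$ to $\mathbb{L}$ (its pullback along the inclusion) satisfies $$\mathcal{Q}_{\mathbb{L}}\;\cong\;\mathcal{O}_{\mathbb{L}}(1)\oplus\mathcal{O}_{\mathbb{L}}^{\oplus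 (N-1)}$$ as holomorphic vector bundles on $\mathbb{L}$. -/

import Mathlib

open scoped LinearAlgebra.Projectivization Manifold ContDiff Bundle

noncomputable section

namespace HoloProj

open Module Bundle Set Topology

/-! ### Complex projective space as a complex manifold -/

section ProjectiveSpace

variable {V : Type*} [NormedAddCommGroup V] [NormedSpace ℂ V]

/-- The quotient topology on the projective space `ℙ ℂ V` of lines in `V`, for the map
`v ↦ [v]` from `V ∖ {0}`. -/
instance instTopologicalSpace : TopologicalSpace (ℙ ℂ V) :=
  TopologicalSpace.coinduced
    (fun v : {v : V // v ≠ 0} => Projectivization.mk' ℂ v) inferInstance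

theorem isQuotientMap_mk :
    IsQuotientMap (fun v : {v : V // v ≠ 0} => Projectivization.mk' ℂ v) where
  surjective x := ⟨⟨x.rep, x.rep_nonzero⟩, x.mk_rep⟩
  isCoinducing := ⟨rfl⟩

variable {E : Type*} [NormedAddCommGroup E] [NormedSpace ℂ E]

/-- Auxiliary: scaling the representative. -/
theorem exists_rep (v : V) (hv : v ≠ 0) :
    ∃ a : ℂ, a ≠ 0 ∧ (Projectivization.mk ℂ v hv).rep = a • v := by
  obtain ⟨a, ha⟩ := Projectivization.exists_smul_eq_mk_rep ℂ v hv
  exact ⟨a, a.ne_zero, ha.symm⟩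

/-- In linear coordinates `e : V ≃ ℂ × E`, `v ↦ (v₀, v')`, the affine coordinate `v' / v₀` of the
point `[v]`; it is meaningful where `v₀ ≠ 0`. -/
def affineCoord (e : V ≃L[ℂ] ℂ × E) (x : ℙ ℂ V) : E := (e x.rep).1⁻¹ • (e x.rep).2

/-- The domain `{[v] | v₀ ≠ 0}` of the affine coordinate. -/
def affineDomain (e : V ≃L[ℂ] ℂ × E) : Set (ℙ ℂ V) := {x | (e x.rep).1 ≠ 0}

theorem mk_mem_affineDomain (e : V ≃L[ℂ] ℂ × E) (v : V) (hv : v ≠ 0) :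
    Projectivization.mk ℂ v hv ∈ affineDomain e ↔ (e v).1 ≠ 0 := by
  obtain ⟨a, ha, h⟩ := exists_rep v hv
  simp [affineDomain, h, ha]

theorem affineCoord_mk (e : V ≃L[ℂ] ℂ × E) (v : V) (hv : v ≠ 0) :
    affineCoord e (Projectivization.mk ℂ v hv) = (e v).1⁻¹ • (e v).2 := by
  obtain ⟨a, ha, h⟩ := exists_rep v hv
  simp only [affineCoord, h, map_smul, Prod.smul_fst, Prod.smul_snd, smul_eq_mul, mul_inv,
    smul_smul]
  congr 1
  field_simp

theorem symm_ne_zero (e : V ≃L[ℂ] ℂ × E) (z : E) : e.symm (1, z) ≠ 0 := by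
  intro h
  have := congrArg (fun v => (e v).1) h
  simp at this

theorem isOpen_affineDomain (e : V ≃L[ℂ] ℂ × E) : IsOpen (affineDomain e) := by
  rw [← isQuotientMap_mk.isOpen_preimage]
  have : (fun v : {v : V // v ≠ 0} => Projectivization.mk' ℂ v) ⁻¹' affineDomain e
      = {v | (e v.1).1 ≠ 0} := by
    ext v
    exact mk_mem_affineDomain e v.1 v.2
  rw [this]
  exact isOpen_ne_fun (by fun_prop) (by fun_prop)

/-- The standard affine chart `[v] ↦ v' / v₀` of projective space in linear coordinates
`e : V ≃ ℂ × E`, `v ↦ (v₀, v')`. Its inverse is `z ↦ [e⁻¹ (1, z)]`. -/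
def affineChart (e : V ≃L[ℂ] ℂ × E) : OpenPartialHomeomorph (ℙ ℂ V) E where
  toFun := affineCoord e
  invFun z := Projectivization.mk ℂ (e.symm (1, z)) (symm_ne_zero e z)
  source := affineDomain e
  target := univ
  map_source' _ _ := mem_univ _
  map_target' z _ := by simp [mk_mem_affineDomain]
  left_inv' x hx := by
    induction x with
    | h v hv =>
      rw [mk_mem_affineDomain] at hx
      rw [Projectivization.mk_eq_mk_iff']
      refine ⟨(e v).1⁻¹, e.injective ?_⟩
      rw [affineCoord_mk, map_smul, e.apply_symm_apply]
      ext <;> simp [hx]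
  right_inv' z _ := by simp [affineCoord_mk]
  open_source := isOpen_affineDomain e
  open_target := isOpen_univ
  continuousOn_toFun := by
    rw [isQuotientMap_mk.continuousOn_isOpen_iff (isOpen_affineDomain e)]
    have : ContinuousOn (fun v : {v : V // v ≠ 0} => (e v.1).1⁻¹ • (e v.1).2)
        ((fun v : {v : V // v ≠ 0} => Projectivization.mk' ℂ v) ⁻¹' affineDomain e) := by
      refine ContinuousOn.smul (ContinuousOn.inv₀ (by fun_prop) ?_) (by fun_prop)
      intro v hv
      exact (mk_mem_affineDomain e v.1 v.2).1 hv
    refine this.congr ?_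
    intro v _
    exact affineCoord_mk e v.1 v.2
  continuousOn_invFun := by
    have h : Continuous fun z : E => (⟨e.symm (1, z), symm_ne_zero e z⟩ : {v : V // v ≠ 0}) :=
      Continuous.subtype_mk (by fun_prop) _
    exact (isQuotientMap_mk.continuous.comp h).continuousOn

@[simp]
theorem affineChart_coe (e : V ≃L[ℂ] ℂ × E) : ⇑(affineChart e) = affineCoord e := rfl

@[simp]
theorem affineChart_source (e : V ≃L[ℂ] ℂ × E) : (affineChart e).source = affineDomain e := rfl

@[simp]
theorem affineChart_target (e : V ≃L[ℂ] ℂ × E) : (affineChart e).target = univ := rfl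

theorem affineChart_symm_apply (e : V ≃L[ℂ] ℂ × E) (z : E) :
    (affineChart e).symm z = Projectivization.mk ℂ (e.symm (1, z)) (symm_ne_zero e z) := rfl

variable {n : ℕ} [hn : Fact (finrank ℂ V = n + 1)]

theorem exists_frame (x : ℙ ℂ V) :
    ∃ e : V ≃L[ℂ] ℂ × EuclideanSpace ℂ (Fin n), x ∈ affineDomain e := by
  have hV : finrank ℂ V = n + 1 := hn.out
  have : FiniteDimensional ℂ V := FiniteDimensional.of_finrank_pos (by omega)
  have e₀ : V ≃L[ℂ] ℂ × EuclideanSpace ℂ (Fin n) :=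
    ContinuousLinearEquiv.ofFinrankEq (by rw [hV]; simp [add_comm])
  obtain ⟨A, hA⟩ := SeparatingDual.exists_continuousLinearEquiv_apply_eq (R := ℂ)
    x.rep_nonzero (symm_ne_zero e₀ 0)
  exact ⟨A.trans e₀, by simp [affineDomain, hA]⟩

/-- Linear coordinates on `V` whose first coordinate does not vanish at the point `x`. -/
def frameAt (x : ℙ ℂ V) : V ≃L[ℂ] ℂ × EuclideanSpace ℂ (Fin n) := (exists_frame x).choose

theorem mem_frameAt (x : ℙ ℂ V) : x ∈ affineDomain (frameAt (n := n) x) :=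
  (exists_frame x).choose_spec

/-- Projective space of an `(n+1)`-dimensional complex vector space, with the atlas of all affine
charts in all systems of linear coordinates. -/
instance instChartedSpace : ChartedSpace (EuclideanSpace ℂ (Fin n)) (ℙ ℂ V) where
  atlas := range affineChart
  chartAt x := affineChart (frameAt x)
  mem_chart_source x := mem_frameAt x
  chart_mem_atlas _ := mem_range_self _

/-- Projective space is a complex manifold: the changes of charts are complex analytic. -/
instance instIsManifold : IsManifold 𝓘(ℂ, EuclideanSpace ℂ (Fin n)) ω (ℙ ℂ V) := by
  refine isManifold_of_contDiffOn _ _ _ ?_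
  rintro _ _ ⟨e, rfl⟩ ⟨e', rfl⟩
  have key : ContDiffOn ℂ ω (fun z : EuclideanSpace ℂ (Fin n) =>
      (e' (e.symm (1, z))).1⁻¹ • (e' (e.symm (1, z))).2) {z | (e' (e.symm (1, z))).1 ≠ 0} := by
    have h : ContDiff ℂ ω fun z : EuclideanSpace ℂ (Fin n) => e' (e.symm (1, z)) := by fun_prop
    exact ((contDiff_fst.comp h).contDiffOn.inv fun z hz => hz).smul
      (contDiff_snd.comp h).contDiffOn
  refine (key.congr ?_).mono ?_
  · intro z _
    simp [affineChart_symm_apply, affineCoord_mk]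
  · intro z hz
    simpa [affineChart_symm_apply, mk_mem_affineDomain] using hz

theorem affineChart_mem_maximalAtlas (e : V ≃L[ℂ] ℂ × EuclideanSpace ℂ (Fin n)) :
    affineChart e ∈
      IsManifold.maximalAtlas 𝓘(ℂ, EuclideanSpace ℂ (Fin n)) ω (ℙ ℂ V) :=
  IsManifold.subset_maximalAtlas (mem_range_self e)

theorem contMDiffOn_affineCoord (e : V ≃L[ℂ] ℂ × EuclideanSpace ℂ (Fin n)) :
    ContMDiffOn 𝓘(ℂ, EuclideanSpace ℂ (Fin n)) 𝓘(ℂ, EuclideanSpace ℂ (Fin n)) ω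
      (affineCoord e) (affineDomain e) :=
  contMDiffOn_of_mem_maximalAtlas (affineChart_mem_maximalAtlas e)

end ProjectiveSpace


/-! ### The tautological line bundle and the quotient bundle -/

section Bundles

variable {V : Type*} [NormedAddCommGroup V] [NormedSpace ℂ V]

/-- The fibre of the tautological line bundle at `x ∈ ℙ(V)`: the line in `V` represented by `x`. -/
def TautologicalBundle (x : ℙ ℂ V) : Type _ := x.submodule

instance (x : ℙ ℂ V) : AddCommGroup (TautologicalBundle x) := inferInstanceAs (AddCommGroup x.submodule)
instance (x : ℙ ℂ V) : Module ℂ (TautologicalBundle x) := inferInstanceAs (Module ℂ x.submodule)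
instance (x : ℙ ℂ V) : TopologicalSpace (TautologicalBundle x) :=
  inferInstanceAs (TopologicalSpace x.submodule)
instance (x : ℙ ℂ V) : IsTopologicalAddGroup (TautologicalBundle x) :=
  inferInstanceAs (IsTopologicalAddGroup x.submodule)
instance (x : ℙ ℂ V) : ContinuousSMul ℂ (TautologicalBundle x) :=
  inferInstanceAs (ContinuousSMul ℂ x.submodule)

/-- The inclusion of the line represented by `x` in `V`. -/
def TautologicalBundle.incl (x : ℙ ℂ V) : TautologicalBundle x →L[ℂ] V := x.submodule.subtypeL

/-- The fibre of the quotient bundle at `x ∈ ℙ(V)`: the quotient of `V` by the line represented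
by `x`. -/
def QuotientBundle (x : ℙ ℂ V) : Type _ := V ⧸ x.submodule

instance (x : ℙ ℂ V) : AddCommGroup (QuotientBundle x) := inferInstanceAs (AddCommGroup (V ⧸ x.submodule))
instance (x : ℙ ℂ V) : Module ℂ (QuotientBundle x) := inferInstanceAs (Module ℂ (V ⧸ x.submodule))
instance (x : ℙ ℂ V) : TopologicalSpace (QuotientBundle x) :=
  inferInstanceAs (TopologicalSpace (V ⧸ x.submodule))
instance (x : ℙ ℂ V) : IsTopologicalAddGroup (QuotientBundle x) :=
  inferInstanceAs (IsTopologicalAddGroup (V ⧸ x.submodule))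
instance (x : ℙ ℂ V) : ContinuousSMul ℂ (QuotientBundle x) :=
  inferInstanceAs (ContinuousSMul ℂ (V ⧸ x.submodule))

/-- The projection of `V` onto its quotient by the line represented by `x`. -/
def QuotientBundle.proj (x : ℙ ℂ V) : V →L[ℂ] QuotientBundle x := x.submodule.mkQL

theorem QuotientBundle.proj_surjective (x : ℙ ℂ V) : Function.Surjective (QuotientBundle.proj x) :=
  x.submodule.mkQ_surjective

theorem QuotientBundle.proj_eq_zero (x : ℙ ℂ V) (v : V) : QuotientBundle.proj x v = 0 ↔ v ∈ x.submodule :=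
  Submodule.Quotient.mk_eq_zero _

variable {E : Type*} [NormedAddCommGroup E] [NormedSpace ℂ E]

/-- The linear map on the quotient of `V` by the line represented by `x` that is induced by a
linear map on `V` vanishing on the line. -/
def QuotientBundle.lift (x : ℙ ℂ V) (f : V →L[ℂ] E) (hf : ∀ v ∈ x.submodule, f v = 0) :
    QuotientBundle x →L[ℂ] E :=
  x.submodule.liftQL f hf

theorem QuotientBundle.lift_proj (x : ℙ ℂ V) (f : V →L[ℂ] E) (hf : ∀ v ∈ x.submodule, f v = 0)
    (v : V) : QuotientBundle.lift x f hf (QuotientBundle.proj x v) = f v := rfl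

theorem mem_submodule_iff (x : ℙ ℂ V) (v : V) : v ∈ x.submodule ↔ ∃ a : ℂ, a • x.rep = v := by
  rw [Projectivization.submodule_eq, Submodule.mem_span_singleton]

/-- The set `{[v] | f v ≠ 0}`, for a linear form `f` on `V`. -/
def formDomain (f : V →L[ℂ] ℂ) : Set (ℙ ℂ V) := {x | f x.rep ≠ 0}

theorem mk_mem_formDomain (f : V →L[ℂ] ℂ) (v : V) (hv : v ≠ 0) :
    Projectivization.mk ℂ v hv ∈ formDomain f ↔ f v ≠ 0 := by
  obtain ⟨a, ha, h⟩ := exists_rep v hv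
  simp [formDomain, h, ha]

theorem isOpen_formDomain (f : V →L[ℂ] ℂ) : IsOpen (formDomain f) := by
  rw [← isQuotientMap_mk.isOpen_preimage]
  have : (fun v : {v : V // v ≠ 0} => Projectivization.mk' ℂ v) ⁻¹' formDomain f
      = {v | f v.1 ≠ 0} := by
    ext v
    exact mk_mem_formDomain f v.1 v.2
  rw [this]
  exact isOpen_ne_fun (by fun_prop) (by fun_prop)

/-- The restriction of the linear form `f` to the fibre of the tautological bundle at `x`.
It is an isomorphism for `x` in `formDomain f`. -/
def tautCoord (f : V →L[ℂ] ℂ) (x : ℙ ℂ V) : TautologicalBundle x →L[ℂ] ℂ :=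
  f.comp (TautologicalBundle.incl x)

/-- The inverse of the coordinate `tautCoord` for `x` in `formDomain f`. -/
def tautCoordInv (f : V →L[ℂ] ℂ) (x : ℙ ℂ V) : ℂ →L[ℂ] TautologicalBundle x :=
  ((f x.rep)⁻¹ • ContinuousLinearMap.id ℂ ℂ).smulRight
    (⟨x.rep, (mem_submodule_iff x _).2 ⟨1, one_smul _ _⟩⟩ : x.submodule)

theorem incl_tautCoordInv (f : V →L[ℂ] ℂ) (x : ℙ ℂ V) (c : ℂ) :
    TautologicalBundle.incl x (tautCoordInv f x c) = ((f x.rep)⁻¹ * c) • x.rep := rfl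

theorem tautCoord_apply (f : V →L[ℂ] ℂ) (x : ℙ ℂ V) (w : TautologicalBundle x) :
    tautCoord f x w = f (TautologicalBundle.incl x w) := rfl

theorem tautCoord_tautCoordInv (f : V →L[ℂ] ℂ) {x : ℙ ℂ V} (hx : x ∈ formDomain f) (c : ℂ) :
    tautCoord f x (tautCoordInv f x c) = c := by
  have hx' : f x.rep ≠ 0 := hx
  simp only [tautCoord_apply, incl_tautCoordInv, map_smul, smul_eq_mul]
  field_simp

theorem tautCoordInv_tautCoord (f : V →L[ℂ] ℂ) {x : ℙ ℂ V} (hx : x ∈ formDomain f)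
    (w : TautologicalBundle x) : tautCoordInv f x (tautCoord f x w) = w := by
  have hx' : f x.rep ≠ 0 := hx
  obtain ⟨a, ha⟩ := (mem_submodule_iff x (TautologicalBundle.incl x w)).1 w.2
  apply Subtype.val_injective
  change TautologicalBundle.incl x (tautCoordInv f x (tautCoord f x w)) =
    TautologicalBundle.incl x w
  rw [incl_tautCoordInv, tautCoord_apply, ← ha]
  simp only [map_smul, smul_eq_mul]
  congr 1
  field_simp

open Classical in
/-- The coordinate `[w] ↦ w' - w₀ • z` on the fibre of the quotient bundle at the point `x` with
affine coordinate `z`, in linear coordinates `e : V ≃ ℂ × E`, `v ↦ (v₀, v')`.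
It is an isomorphism for `x` in `affineDomain e` (and set to be `0` elsewhere). -/
def quotCoord (e : V ≃L[ℂ] ℂ × E) (x : ℙ ℂ V) : QuotientBundle x →L[ℂ] E :=
  if hx : x ∈ affineDomain e then
    QuotientBundle.lift x
      (((ContinuousLinearMap.snd ℂ ℂ E) -
        (ContinuousLinearMap.fst ℂ ℂ E).smulRight (affineCoord e x)).comp (e : V →L[ℂ] ℂ × E))
      (by
        have hx' : (e x.rep).1 ≠ 0 := hx
        intro v hv
        obtain ⟨a, rfl⟩ := (mem_submodule_iff x v).1 hv
        simp [affineCoord, smul_smul, hx'])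
  else 0

/-- The inverse of the coordinate `quotCoord` for `x` in `affineDomain e`. -/
def quotCoordInv (e : V ≃L[ℂ] ℂ × E) (x : ℙ ℂ V) : E →L[ℂ] QuotientBundle x :=
  (QuotientBundle.proj x).comp ((e.symm : ℂ × E →L[ℂ] V).comp (ContinuousLinearMap.inr ℂ ℂ E))

theorem quotCoord_proj (e : V ≃L[ℂ] ℂ × E) {x : ℙ ℂ V} (hx : x ∈ affineDomain e) (v : V) :
    quotCoord e x (QuotientBundle.proj x v) = (e v).2 - (e v).1 • affineCoord e x := by
  rw [quotCoord, dif_pos hx, QuotientBundle.lift_proj]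
  rfl

theorem quotCoordInv_apply (e : V ≃L[ℂ] ℂ × E) (x : ℙ ℂ V) (z : E) :
    quotCoordInv e x z = QuotientBundle.proj x (e.symm (0, z)) := rfl

theorem quotCoord_quotCoordInv (e : V ≃L[ℂ] ℂ × E) {x : ℙ ℂ V} (hx : x ∈ affineDomain e) (z : E) :
    quotCoord e x (quotCoordInv e x z) = z := by
  simp [quotCoordInv_apply, quotCoord_proj e hx]

theorem quotCoordInv_quotCoord (e : V ≃L[ℂ] ℂ × E) {x : ℙ ℂ V} (hx : x ∈ affineDomain e)
    (q : QuotientBundle x) : quotCoordInv e x (quotCoord e x q) = q := by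
  have hx' : (e x.rep).1 ≠ 0 := hx
  obtain ⟨v, rfl⟩ := QuotientBundle.proj_surjective x q
  rw [quotCoord_proj e hx, quotCoordInv_apply, ← sub_eq_zero, ← map_sub, QuotientBundle.proj_eq_zero,
    mem_submodule_iff]
  refine ⟨-((e v).1 * (e x.rep).1⁻¹), e.injective ?_⟩
  ext
  · simp [hx']
  · simp [affineCoord, smul_smul]

/-- The local trivialization `(x, w) ↦ (x, f w)` of the tautological line
bundle over the set `{[v] | f v ≠ 0}`, for a linear form `f` on `V`. -/
def tautPretriv (f : V →L[ℂ] ℂ) : Pretrivialization ℂ (π ℂ (TautologicalBundle (V := V))) where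
  toFun p := (p.1, tautCoord f p.1 p.2)
  invFun p := ⟨p.1, tautCoordInv f p.1 p.2⟩
  source := π ℂ (TautologicalBundle (V := V)) ⁻¹' formDomain f
  target := formDomain f ×ˢ univ
  map_source' p hp := ⟨hp, mem_univ _⟩
  map_target' p hp := hp.1
  left_inv' p hp := by
    obtain ⟨x, w⟩ := p
    exact congrArg (TotalSpace.mk x) (tautCoordInv_tautCoord f hp w)
  right_inv' p hp := Prod.ext rfl (tautCoord_tautCoordInv f hp.1 p.2)
  open_target := (isOpen_formDomain f).prod isOpen_univ
  baseSet := formDomain f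
  open_baseSet := isOpen_formDomain f
  source_eq := rfl
  target_eq := rfl
  proj_toFun _ _ := rfl

/-- The local trivialization `(x, [w]) ↦ (x, w' - w₀ • z(x))` of the quotient bundle. -/
def quotPretriv (e : V ≃L[ℂ] ℂ × E) : Pretrivialization E (π E (QuotientBundle (V := V))) where
  toFun p := (p.1, quotCoord e p.1 p.2)
  invFun p := ⟨p.1, quotCoordInv e p.1 p.2⟩
  source := π E (QuotientBundle (V := V)) ⁻¹' affineDomain e
  target := affineDomain e ×ˢ univ
  map_source' p hp := ⟨hp, mem_univ _⟩
  map_target' p hp := hp.1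
  left_inv' p hp := by
    obtain ⟨x, w⟩ := p
    exact congrArg (TotalSpace.mk x) (quotCoordInv_quotCoord e hp w)
  right_inv' p hp := Prod.ext rfl (quotCoord_quotCoordInv e hp.1 p.2)
  open_target := (isOpen_affineDomain e).prod isOpen_univ
  baseSet := affineDomain e
  open_baseSet := isOpen_affineDomain e
  source_eq := rfl
  target_eq := rfl
  proj_toFun _ _ := rfl

theorem tautPretriv_symm (f : V →L[ℂ] ℂ) {x : ℙ ℂ V} (hx : x ∈ formDomain f) (c : ℂ) :
    (tautPretriv f).symm x c = tautCoordInv f x c := by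
  rw [Pretrivialization.symm_apply (tautPretriv f) hx c]
  rfl

theorem quotPretriv_symm (e : V ≃L[ℂ] ℂ × E) {x : ℙ ℂ V} (hx : x ∈ affineDomain e) (z : E) :
    (quotPretriv e).symm x z = quotCoordInv e x z := by
  rw [Pretrivialization.symm_apply (quotPretriv e) hx z]
  rfl

instance (f : V →L[ℂ] ℂ) : (tautPretriv f).IsLinear ℂ where
  linear x _ := (tautCoord f x).toLinearMap.isLinear

instance (e : V ≃L[ℂ] ℂ × E) : (quotPretriv e).IsLinear ℂ where
  linear x _ := (quotCoord e x).toLinearMap.isLinear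

/-- Transition functions `f' / f` of the tautological line bundle. -/
def tautChange (f f' : V →L[ℂ] ℂ) (x : ℙ ℂ V) : ℂ →L[ℂ] ℂ :=
  ((f x.rep)⁻¹ * f' x.rep) • ContinuousLinearMap.id ℂ ℂ

theorem tautChange_apply (f f' : V →L[ℂ] ℂ) (x : ℙ ℂ V) (c : ℂ) :
    tautChange f f' x c = tautCoord f' x (tautCoordInv f x c) := by
  simp only [tautChange, tautCoord_apply, incl_tautCoordInv]
  simp
  ring

theorem tautChange_mk (f f' : V →L[ℂ] ℂ) (v : V) (hv : v ≠ 0) :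
    tautChange f f' (Projectivization.mk ℂ v hv) =
      ((f v)⁻¹ * f' v) • ContinuousLinearMap.id ℂ ℂ := by
  obtain ⟨a, ha, h⟩ := exists_rep v hv
  simp only [tautChange, h, map_smul, smul_eq_mul, mul_inv]
  congr 1
  field_simp

theorem continuousOn_tautChange (f f' : V →L[ℂ] ℂ) :
    ContinuousOn (tautChange f f') (formDomain f) := by
  rw [isQuotientMap_mk.continuousOn_isOpen_iff (isOpen_formDomain f)]
  have : ContinuousOn
      (fun v : {v : V // v ≠ 0} => ((f v.1)⁻¹ * f' v.1) • ContinuousLinearMap.id ℂ ℂ)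
      ((fun v : {v : V // v ≠ 0} => Projectivization.mk' ℂ v) ⁻¹' formDomain f) := by
    have h₁ : Continuous fun v : {v : V // v ≠ 0} => f v.1 := by fun_prop
    have h₂ : Continuous fun v : {v : V // v ≠ 0} => f' v.1 := by fun_prop
    refine ((h₁.continuousOn.inv₀ ?_).mul h₂.continuousOn).smul continuousOn_const
    intro v hv
    exact (mk_mem_formDomain f v.1 v.2).1 hv
  refine this.congr ?_
  intro v _
  exact tautChange_mk f f' v.1 v.2

theorem exists_form (x : ℙ ℂ V) : ∃ f : V →L[ℂ] ℂ, x ∈ formDomain f :=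
  SeparatingDual.exists_ne_zero x.rep_nonzero

/-- A linear form on `V` that does not vanish at the point `x`. -/
def formAt (x : ℙ ℂ V) : V →L[ℂ] ℂ := (exists_form x).choose

theorem mem_formAt (x : ℙ ℂ V) : x ∈ formDomain (formAt x) := (exists_form x).choose_spec

/-- The bundle atlas of the tautological line bundle. -/
def tautPrebundle : VectorPrebundle ℂ ℂ (TautologicalBundle (V := V)) where
  pretrivializationAtlas := range fun f : V →L[ℂ] ℂ => tautPretriv f
  pretrivialization_linear' := by
    rintro _ ⟨f, rfl⟩
    infer_instance
  pretrivializationAt x := tautPretriv (formAt x)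
  mem_base_pretrivializationAt x := mem_formAt x
  pretrivialization_mem_atlas _ := mem_range_self _
  exists_coordChange := by
    rintro _ ⟨f, rfl⟩ _ ⟨f', rfl⟩
    refine ⟨tautChange f f', (continuousOn_tautChange f f').mono inter_subset_left, ?_⟩
    intro x hx c
    rw [tautChange_apply f f', tautPretriv_symm f hx.1]
    rfl
  totalSpaceMk_isInducing x := by
    have h : Function.LeftInverse (tautCoordInv (formAt x) x) (tautCoord (formAt x) x) :=
      tautCoordInv_tautCoord _ (mem_formAt x)
    exact (isInducing_const_prod (X := ℙ ℂ V)).2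
      (IsEmbedding.of_leftInverse h (tautCoordInv _ x).continuous
        (tautCoord _ x).continuous).isInducing

instance : TopologicalSpace (TotalSpace ℂ (TautologicalBundle (V := V))) :=
  tautPrebundle.totalSpaceTopology

/-- The tautological line bundle `{(x, w) | w ∈ x}` over `ℙ(V)`. -/
instance : FiberBundle ℂ (TautologicalBundle (V := V)) := tautPrebundle.toFiberBundle

instance : VectorBundle ℂ ℂ (TautologicalBundle (V := V)) := tautPrebundle.toVectorBundle

variable {n : ℕ}

/-- Transition functions of the quotient bundle. -/
def quotChange (e e' : V ≃L[ℂ] ℂ × EuclideanSpace ℂ (Fin n)) (x : ℙ ℂ V) :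
    EuclideanSpace ℂ (Fin n) →L[ℂ] EuclideanSpace ℂ (Fin n) :=
  ((ContinuousLinearMap.snd ℂ ℂ (EuclideanSpace ℂ (Fin n))) -
    (ContinuousLinearMap.fst ℂ ℂ (EuclideanSpace ℂ (Fin n))).smulRight (affineCoord e' x)).comp
    (((e.symm.trans e' : (ℂ × EuclideanSpace ℂ (Fin n)) ≃L[ℂ] ℂ × EuclideanSpace ℂ (Fin n)) :
      ℂ × EuclideanSpace ℂ (Fin n) →L[ℂ] ℂ × EuclideanSpace ℂ (Fin n)).comp
      (ContinuousLinearMap.inr ℂ ℂ (EuclideanSpace ℂ (Fin n))))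

theorem quotChange_apply (e e' : V ≃L[ℂ] ℂ × EuclideanSpace ℂ (Fin n)) {x : ℙ ℂ V}
    (hx' : x ∈ affineDomain e') (z : EuclideanSpace ℂ (Fin n)) :
    quotChange e e' x z = quotCoord e' x (quotCoordInv e x z) := by
  rw [quotCoordInv_apply, quotCoord_proj e' hx']
  rfl

variable [hn : Fact (finrank ℂ V = n + 1)]

theorem contMDiffOn_tautChange (f f' : V →L[ℂ] ℂ) :
    ContMDiffOn 𝓘(ℂ, EuclideanSpace ℂ (Fin n)) 𝓘(ℂ, ℂ →L[ℂ] ℂ) ω (tautChange f f')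
      (formDomain f) := by
  intro x hx
  let e : V ≃L[ℂ] ℂ × EuclideanSpace ℂ (Fin n) := frameAt x
  have hc : ∀ y ∈ affineDomain e,
      Projectivization.mk ℂ (e.symm (1, affineCoord e y)) (symm_ne_zero e _) = y :=
    fun y hy => (affineChart e).left_inv hy
  have h : ContDiffOn ℂ ω (fun z : EuclideanSpace ℂ (Fin n) =>
      ((f (e.symm (1, z)))⁻¹ * f' (e.symm (1, z))) • ContinuousLinearMap.id ℂ ℂ)
      {z | f (e.symm (1, z)) ≠ 0} := by
    have h₁ : ContDiff ℂ ω fun z : EuclideanSpace ℂ (Fin n) => f (e.symm (1, z)) := by fun_prop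
    have h₂ : ContDiff ℂ ω fun z : EuclideanSpace ℂ (Fin n) => f' (e.symm (1, z)) := by fun_prop
    exact ((h₁.contDiffOn.inv fun z hz => hz).mul h₂.contDiffOn).smul contDiffOn_const
  have hm := h.contMDiffOn.comp
    ((contMDiffOn_affineCoord e).mono (inter_subset_left (t := formDomain f))) (by
      intro y hy
      have := hy.2
      rwa [← hc y hy.1, mk_mem_formDomain] at this)
  have hm' : ContMDiffOn 𝓘(ℂ, EuclideanSpace ℂ (Fin n)) 𝓘(ℂ, ℂ →L[ℂ] ℂ) ω (tautChange f f')
      (affineDomain e ∩ formDomain f) := by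
    refine hm.congr ?_
    intro y hy
    conv_lhs => rw [← hc y hy.1]
    exact tautChange_mk f f' _ _
  exact (hm'.contMDiffAt (((isOpen_affineDomain e).inter (isOpen_formDomain f)).mem_nhds
    ⟨mem_frameAt x, hx⟩)).contMDiffWithinAt

theorem contMDiffOn_quotChange (e e' : V ≃L[ℂ] ℂ × EuclideanSpace ℂ (Fin n)) :
    ContMDiffOn 𝓘(ℂ, EuclideanSpace ℂ (Fin n))
      𝓘(ℂ, EuclideanSpace ℂ (Fin n) →L[ℂ] EuclideanSpace ℂ (Fin n)) ω (quotChange e e')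
      (affineDomain e') := by
  have h : ContDiff ℂ ω fun z : EuclideanSpace ℂ (Fin n) =>
      ((ContinuousLinearMap.snd ℂ ℂ (EuclideanSpace ℂ (Fin n))) -
        (ContinuousLinearMap.fst ℂ ℂ (EuclideanSpace ℂ (Fin n))).smulRight z).comp
      (((e.symm.trans e' : (ℂ × EuclideanSpace ℂ (Fin n)) ≃L[ℂ] ℂ × EuclideanSpace ℂ (Fin n)) :
        ℂ × EuclideanSpace ℂ (Fin n) →L[ℂ] ℂ × EuclideanSpace ℂ (Fin n)).comp
        (ContinuousLinearMap.inr ℂ ℂ (EuclideanSpace ℂ (Fin n)))) := by fun_prop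
  exact h.contMDiff.comp_contMDiffOn (contMDiffOn_affineCoord e')

/-- The bundle atlas of the quotient bundle. -/
def quotPrebundle : VectorPrebundle ℂ (EuclideanSpace ℂ (Fin n)) (QuotientBundle (V := V)) where
  pretrivializationAtlas := range fun e : V ≃L[ℂ] ℂ × EuclideanSpace ℂ (Fin n) => quotPretriv e
  pretrivialization_linear' := by
    rintro _ ⟨e, rfl⟩
    infer_instance
  pretrivializationAt x := quotPretriv (frameAt (n := n) x)
  mem_base_pretrivializationAt x := mem_frameAt x
  pretrivialization_mem_atlas _ := mem_range_self _
  exists_coordChange := by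
    rintro _ ⟨e, rfl⟩ _ ⟨e', rfl⟩
    refine ⟨quotChange e e', (contMDiffOn_quotChange e e').continuousOn.mono inter_subset_right, ?_⟩
    intro x hx z
    rw [quotChange_apply e e' hx.2, quotPretriv_symm e hx.1]
    rfl
  totalSpaceMk_isInducing x := by
    have h : Function.LeftInverse (quotCoordInv (frameAt (n := n) x) x)
        (quotCoord (frameAt (n := n) x) x) :=
      quotCoordInv_quotCoord _ (mem_frameAt x)
    exact (isInducing_const_prod (X := ℙ ℂ V)).2
      (IsEmbedding.of_leftInverse h (quotCoordInv _ x).continuous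
        (quotCoord _ x).continuous).isInducing

instance tautPrebundle_isContMDiff :
    (tautPrebundle (V := V)).IsContMDiff 𝓘(ℂ, EuclideanSpace ℂ (Fin n)) ω where
  exists_contMDiffCoordChange := by
    rintro _ ⟨f, rfl⟩ _ ⟨f', rfl⟩
    refine ⟨tautChange f f', (contMDiffOn_tautChange f f').mono inter_subset_left, ?_⟩
    intro x hx c
    rw [tautChange_apply f f', tautPretriv_symm f hx.1]
    rfl

/-- The tautological line bundle is a holomorphic vector bundle. -/
instance : ContMDiffVectorBundle ω ℂ (TautologicalBundle (V := V))
    𝓘(ℂ, EuclideanSpace ℂ (Fin n)) :=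
  tautPrebundle.contMDiffVectorBundle _

instance : TopologicalSpace
    (TotalSpace (EuclideanSpace ℂ (Fin n)) (QuotientBundle (V := V))) :=
  quotPrebundle.totalSpaceTopology

/-- The quotient bundle, of rank `n`, over the projective space of an `(n+1)`-dimensional vector
space `V`: the quotient of the trivial bundle `ℙ(V) × V` by the tautological line bundle. -/
instance : FiberBundle (EuclideanSpace ℂ (Fin n)) (QuotientBundle (V := V)) :=
  quotPrebundle.toFiberBundle

instance : VectorBundle ℂ (EuclideanSpace ℂ (Fin n)) (QuotientBundle (V := V)) :=
  quotPrebundle.toVectorBundle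

instance quotPrebundle_isContMDiff :
    (quotPrebundle (V := V) (n := n)).IsContMDiff 𝓘(ℂ, EuclideanSpace ℂ (Fin n)) ω where
  exists_contMDiffCoordChange := by
    rintro _ ⟨e, rfl⟩ _ ⟨e', rfl⟩
    refine ⟨quotChange e e', (contMDiffOn_quotChange e e').mono inter_subset_right, ?_⟩
    intro x hx z
    rw [quotChange_apply e e' hx.2, quotPretriv_symm e hx.1]
    rfl

/-- The quotient bundle is a holomorphic vector bundle. -/
instance : ContMDiffVectorBundle ω (EuclideanSpace ℂ (Fin n)) (QuotientBundle (V := V))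
    𝓘(ℂ, EuclideanSpace ℂ (Fin n)) :=
  quotPrebundle.contMDiffVectorBundle _

/-- The hyperplane bundle `𝓞(1)` over `ℙ(V)`: the dual of the tautological line bundle, whose fibre
at `x` is the space of linear forms on the line represented by `x`. -/
abbrev HyperplaneBundle (x : ℙ ℂ V) : Type _ :=
  TautologicalBundle x →L[ℂ] Bundle.Trivial (ℙ ℂ V) ℂ x

end Bundles


/-! ### Lines in projective space -/

section Lines

variable {V : Type*} [NormedAddCommGroup V] [NormedSpace ℂ V] {N k : ℕ}
  [hV : Fact (finrank ℂ V = N + 1)] (W : Submodule ℂ V) [hW : Fact (finrank ℂ W = k + 1)]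

theorem contMDiff_linearInclusion :
    ContMDiff 𝓘(ℂ, EuclideanSpace ℂ (Fin k)) 𝓘(ℂ, EuclideanSpace ℂ (Fin N)) ω
      (Projectivization.map W.subtype W.injective_subtype) := by
  intro x
  let e : W ≃L[ℂ] ℂ × EuclideanSpace ℂ (Fin k) := frameAt x
  let e' : V ≃L[ℂ] ℂ × EuclideanSpace ℂ (Fin N) :=
    frameAt (Projectivization.map W.subtype W.injective_subtype x)
  have hne : ∀ z, (e.symm (1, z) : V) ≠ 0 := fun z h =>
    symm_ne_zero e z (Subtype.val_injective h)
  have hc : ∀ y ∈ affineDomain e, Projectivization.map W.subtype W.injective_subtype y =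
      Projectivization.mk ℂ (e.symm (1, affineCoord e y) : V) (hne _) := by
    intro y hy
    conv_lhs => rw [← (affineChart e).left_inv hy]
    rfl
  have hx : (e' (e.symm (1, affineCoord e x))).1 ≠ 0 := by
    have := mem_frameAt (n := N) (Projectivization.map W.subtype W.injective_subtype x)
    rwa [hc x (mem_frameAt x), mk_mem_affineDomain, ← hc x (mem_frameAt x)] at this
  have h₁ : ContDiff ℂ ω fun z : EuclideanSpace ℂ (Fin k) => e' (W.subtypeL (e.symm (1, z))) := by
    fun_prop
  have hs : IsOpen {z : EuclideanSpace ℂ (Fin k) | (e' (W.subtypeL (e.symm (1, z)))).1 ≠ 0} :=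
    isOpen_ne_fun (by fun_prop) (by fun_prop)
  have h₂ : ContDiffAt ℂ ω (fun z : EuclideanSpace ℂ (Fin k) =>
      (e' (W.subtypeL (e.symm (1, z)))).1⁻¹ • (e' (W.subtypeL (e.symm (1, z)))).2)
      (affineCoord e x) :=
    ((contDiff_fst.comp h₁).contDiffAt.inv hx).smul (contDiff_snd.comp h₁).contDiffAt
  have hex : ContMDiffAt 𝓘(ℂ, EuclideanSpace ℂ (Fin k)) 𝓘(ℂ, EuclideanSpace ℂ (Fin k)) ω
      (affineCoord e) x :=
    (contMDiffOn_affineCoord e).contMDiffAt ((isOpen_affineDomain e).mem_nhds (mem_frameAt x))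
  have h₃ := h₂.contMDiffAt.comp x hex
  have h₄ := (contMDiffOn_symm_of_mem_maximalAtlas
    (affineChart_mem_maximalAtlas e')).contMDiffAt (Filter.univ_mem' fun _ => mem_univ _)
    |>.comp x h₃
  refine h₄.congr_of_eventuallyEq ?_
  filter_upwards [(isOpen_affineDomain e).mem_nhds (mem_frameAt x),
    hex.continuousAt.preimage_mem_nhds (hs.mem_nhds hx)] with y hy hy'
  have hy'' : (e' (e.symm (1, affineCoord e y))).1 ≠ 0 := hy'
  rw [hc y hy]
  have hm := (mk_mem_affineDomain e' _ (hne (affineCoord e y))).2 hy''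
  refine ((affineChart e').left_inv hm).symm.trans ?_
  simp only [affineChart_coe, affineCoord_mk]
  rfl

/-- The inclusion `ℙ(W) ⊆ ℙ(V)` of the linear subspace of `ℙ(V)` given by a linear subspace
`W ⊆ V`, as a holomorphic map. The lines in `ℙ(V)` are the subspaces `ℙ(W)` with `dim W = 2`. -/
def linearInclusion :
    C^ω⟮𝓘(ℂ, EuclideanSpace ℂ (Fin k)), ℙ ℂ W; 𝓘(ℂ, EuclideanSpace ℂ (Fin N)), ℙ ℂ V⟯ :=
  ⟨Projectivization.map W.subtype W.injective_subtype, contMDiff_linearInclusion W⟩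

end Lines

/-! ### Isomorphisms of holomorphic vector bundles -/

section Iso

variable {EB HB B : Type*} [NormedAddCommGroup EB] [NormedSpace ℂ EB] [TopologicalSpace HB]
  (IB : ModelWithCorners ℂ EB HB) [TopologicalSpace B] [ChartedSpace HB B]
  (F₁ : Type*) [NormedAddCommGroup F₁] [NormedSpace ℂ F₁] (E₁ : B → Type*)
  [∀ x, AddCommMonoid (E₁ x)] [∀ x, Module ℂ (E₁ x)] [∀ x, TopologicalSpace (E₁ x)]
  [TopologicalSpace (TotalSpace F₁ E₁)] [FiberBundle F₁ E₁]
  (F₂ : Type*) [NormedAddCommGroup F₂] [NormedSpace ℂ F₂] (E₂ : B → Type*)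
  [∀ x, AddCommMonoid (E₂ x)] [∀ x, Module ℂ (E₂ x)] [∀ x, TopologicalSpace (E₂ x)]
  [TopologicalSpace (TotalSpace F₂ E₂)] [FiberBundle F₂ E₂]

/-- An isomorphism of holomorphic vector bundles over `B`: a family of linear isomorphisms of the
fibres such that the resulting map of total spaces and its inverse are holomorphic. -/
structure HolomorphicBundleIso where
  toLinearEquiv : ∀ x, E₁ x ≃ₗ[ℂ] E₂ x
  contMDiff_toFun : ContMDiff (IB.prod 𝓘(ℂ, F₁)) (IB.prod 𝓘(ℂ, F₂)) ω
    fun p : TotalSpace F₁ E₁ => TotalSpace.mk' F₂ p.1 (toLinearEquiv p.1 p.2)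
  contMDiff_invFun : ContMDiff (IB.prod 𝓘(ℂ, F₂)) (IB.prod 𝓘(ℂ, F₁)) ω
    fun p : TotalSpace F₂ E₂ => TotalSpace.mk' F₁ p.1 ((toLinearEquiv p.1).symm p.2)

end Iso

end HoloProj

end

/-! Let `ℓ ⊆ W` be the line represented by a point `x` of `ℙ(W)`. A complement `G` of `W` in `V`
gives `V/ℓ ≅ W/ℓ ⊕ G`, where `G` does not depend on `x` and has dimension `N - 1`. On the plane `W`,
a fixed nonzero alternating form identifies `W/ℓ` with the dual of `ℓ`: the functional `det(w, ·)`
restricted to `ℓ` vanishes exactly when `w ∈ ℓ`, and every functional on `ℓ` arises in this way. The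
form and the complement are chosen once for all `x`, so these fibrewise isomorphisms form a global
family and no gluing is needed.

The fibrewise statement rests on `splitFibreMap_eq_zero_iff` (the kernel is `ℓ`) and
`splitFibreMap_surjective`. For holomorphy, the matrix of the family in local trivializations is
`splitCoord`, which is affine in the vector `s ∈ ℓ` normalized by `f s = 1`; this vector is
holomorphic in `x` by `contMDiffAt_normalizedRep`. Holomorphy of the inverse follows from
`nonempty_holomorphicBundleIso`, because inversion of linear maps is analytic at invertible ones. -/

noncomputable section

namespace HoloProj

open Module Bundle Set Topology

/-! ### Holomorphy of bundle maps from their local matrices -/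

section LocalCriterion

variable {EB HB B : Type*} [NormedAddCommGroup EB] [NormedSpace ℂ EB] [TopologicalSpace HB]
  {IB : ModelWithCorners ℂ EB HB} [TopologicalSpace B] [ChartedSpace HB B]
  {F₁ : Type*} [NormedAddCommGroup F₁] [NormedSpace ℂ F₁] {E₁ : B → Type*}
  [∀ x, TopologicalSpace (E₁ x)]
  [TopologicalSpace (TotalSpace F₁ E₁)] [FiberBundle F₁ E₁]
  {F₂ : Type*} [NormedAddCommGroup F₂] [NormedSpace ℂ F₂] {E₂ : B → Type*}
  [∀ x, TopologicalSpace (E₂ x)]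
  [TopologicalSpace (TotalSpace F₂ E₂)] [FiberBundle F₂ E₂]

/-- A map of bundles that is given in local trivializations by a holomorphic family of linear maps
is holomorphic. -/
theorem contMDiff_of_trivializationAt_eq (φ : ∀ x, E₁ x → E₂ x) (A : B → B → F₁ →L[ℂ] F₂)
    (hA : ∀ x₀, ContMDiffAt IB 𝓘(ℂ, F₁ →L[ℂ] F₂) ω (A x₀) x₀)
    (h : ∀ x₀, ∀ᶠ x in 𝓝 x₀, ∀ v : E₁ x, (trivializationAt F₂ E₂ x₀ ⟨x, φ x v⟩).2 =
      A x₀ x (trivializationAt F₁ E₁ x₀ ⟨x, v⟩).2) :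
    ContMDiff (IB.prod 𝓘(ℂ, F₁)) (IB.prod 𝓘(ℂ, F₂)) ω
      fun p : TotalSpace F₁ E₁ => TotalSpace.mk' F₂ p.1 (φ p.1 p.2) := by
  intro p₀
  rw [contMDiffAt_totalSpace]
  have hp := contMDiff_proj (n := ω) (IB := IB) E₁ p₀
  refine ⟨hp, ?_⟩
  -- Holomorphy of the identity of the total space says that the fibre coordinate is a holomorphic
  -- function.
  have hid := (contMDiffAt_totalSpace.1
    (contMDiffAt_id (I := IB.prod 𝓘(ℂ, F₁)) (n := ω) (x := p₀))).2
  refine (((hA p₀.1).comp p₀ hp).clm_apply hid).congr_of_eventuallyEq ?_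
  filter_upwards [hp.continuousAt.eventually (h p₀.1)] with p hp
  exact hp p.2

/-- A family of linear isomorphisms that is given in local trivializations by a holomorphic family
of linear maps is an isomorphism of holomorphic vector bundles. -/
theorem nonempty_holomorphicBundleIso [FiniteDimensional ℂ F₁]
    [∀ x, AddCommMonoid (E₁ x)] [∀ x, Module ℂ (E₁ x)] [VectorBundle ℂ F₁ E₁]
    [∀ x, AddCommMonoid (E₂ x)] [∀ x, Module ℂ (E₂ x)] [VectorBundle ℂ F₂ E₂]
    (φ : ∀ x, E₁ x ≃ₗ[ℂ] E₂ x) (A : B → B → F₁ →L[ℂ] F₂)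
    (hA : ∀ x₀, ContMDiffAt IB 𝓘(ℂ, F₁ →L[ℂ] F₂) ω (A x₀) x₀)
    (h : ∀ x₀, ∀ᶠ x in 𝓝 x₀, ∀ v : E₁ x, (trivializationAt F₂ E₂ x₀ ⟨x, φ x v⟩).2 =
      A x₀ x (trivializationAt F₁ E₁ x₀ ⟨x, v⟩).2) :
    Nonempty (HolomorphicBundleIso IB F₁ E₁ F₂ E₂) := by
  have : CompleteSpace F₁ := FiniteDimensional.complete ℂ F₁
  -- Over both base sets the relation forces `A x₀ x` to be `φ x` conjugated by the two
  -- trivializations, hence bijective; finite dimension of `F₁` makes it a continuous equivalence.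
  have hinv : ∀ x₀ x, x ∈ (trivializationAt F₁ E₁ x₀).baseSet →
      x ∈ (trivializationAt F₂ E₂ x₀).baseSet →
      (∀ v : E₁ x, (trivializationAt F₂ E₂ x₀ ⟨x, φ x v⟩).2 =
        A x₀ x (trivializationAt F₁ E₁ x₀ ⟨x, v⟩).2) →
      ∃ M : F₁ ≃L[ℂ] F₂, A x₀ x = M := by
    intro x₀ x h₁ h₂ hx
    let M := ((trivializationAt F₁ E₁ x₀).linearEquivAt ℂ x h₁).symm ≪≫ₗ φ x ≪≫ₗ
      (trivializationAt F₂ E₂ x₀).linearEquivAt ℂ x h₂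
    refine ⟨M.toContinuousLinearEquiv, ?_⟩
    ext z
    obtain ⟨v, rfl⟩ := ((trivializationAt F₁ E₁ x₀).linearEquivAt ℂ x h₁).surjective z
    refine (hx v).symm.trans ?_
    change _ = M _
    simp only [M, LinearEquiv.trans_apply, LinearEquiv.symm_apply_apply]
    rfl
  have hbase : ∀ x₀ : B, ∀ᶠ x in 𝓝 x₀, x ∈ (trivializationAt F₁ E₁ x₀).baseSet ∧
      x ∈ (trivializationAt F₂ E₂ x₀).baseSet := fun x₀ =>
    Filter.Eventually.and
      ((trivializationAt F₁ E₁ x₀).open_baseSet.mem_nhds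
        (FiberBundle.mem_baseSet_trivializationAt' x₀))
      ((trivializationAt F₂ E₂ x₀).open_baseSet.mem_nhds
        (FiberBundle.mem_baseSet_trivializationAt' x₀))
  refine ⟨φ, contMDiff_of_trivializationAt_eq (fun x => φ x) A hA h,
    contMDiff_of_trivializationAt_eq (fun x => (φ x).symm)
      (fun x₀ x => ContinuousLinearMap.inverse (A x₀ x)) ?_ ?_⟩
  · intro x₀
    obtain ⟨M, hM⟩ := hinv x₀ x₀ (hbase x₀).self_of_nhds.1 (hbase x₀).self_of_nhds.2
      (h x₀).self_of_nhds
    -- `ContinuousLinearMap.inverse` takes the value `0` at non-invertible maps, so analyticity is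
    -- available only at an equivalence, here `A x₀ x₀`.
    have := contDiffAt_map_inverse (n := ω) M
    rw [← hM] at this
    exact this.contMDiffAt.comp x₀ (hA x₀)
  · intro x₀
    -- At every point near `x₀` the matrix is invertible, so `inverse` is the true inverse there and
    -- the relation for `φ` can be solved for `(φ x).symm`.
    filter_upwards [h x₀, hbase x₀] with x hx hb v
    obtain ⟨M, hM⟩ := hinv x₀ x hb.1 hb.2 hx
    have := hx ((φ x).symm v)
    rw [LinearEquiv.apply_symm_apply] at this
    rw [this, hM, ContinuousLinearMap.inverse_equiv]
    simp

end LocalCriterion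

/-! ### Holomorphic local representatives of points -/

section NormalizedRep

variable {V : Type*} [NormedAddCommGroup V] [NormedSpace ℂ V] {n : ℕ}
  [Fact (finrank ℂ V = n + 1)]

/-- The representative `v` of a point of `formDomain f` with `f v = 1`. -/
def normalizedRep (f : V →L[ℂ] ℂ) (x : ℙ ℂ V) : V := (f x.rep)⁻¹ • x.rep

theorem normalizedRep_mk (f : V →L[ℂ] ℂ) (v : V) (hv : v ≠ 0) :
    normalizedRep f (Projectivization.mk ℂ v hv) = (f v)⁻¹ • v := by
  obtain ⟨a, ha, h⟩ := exists_rep v hv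
  simp only [normalizedRep, h, map_smul, smul_eq_mul, mul_inv, smul_smul]
  congr 1
  field_simp

/-- `normalizedRep f` does not depend on the chosen representative, so `x.rep`, which need not vary
continuously, may be replaced by `e.symm (1, z)` with `z` the affine coordinate. -/
theorem contMDiffAt_normalizedRep (f : V →L[ℂ] ℂ) {x : ℙ ℂ V} (hx : x ∈ formDomain f) :
    ContMDiffAt 𝓘(ℂ, EuclideanSpace ℂ (Fin n)) 𝓘(ℂ, V) ω (normalizedRep f) x := by
  let e : V ≃L[ℂ] ℂ × EuclideanSpace ℂ (Fin n) := frameAt x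
  have hc : ∀ y ∈ affineDomain e,
      Projectivization.mk ℂ (e.symm (1, affineCoord e y)) (symm_ne_zero e _) = y :=
    fun y hy => (affineChart e).left_inv hy
  have hx' : f (e.symm (1, affineCoord e x)) ≠ 0 := by
    rwa [← hc x (mem_frameAt x), mk_mem_formDomain] at hx
  have h₁ : ContDiff ℂ ω fun z : EuclideanSpace ℂ (Fin n) => f (e.symm (1, z)) := by fun_prop
  have h₂ : ContDiff ℂ ω fun z : EuclideanSpace ℂ (Fin n) => e.symm (1, z) := by fun_prop
  have h₃ : ContDiffAt ℂ ω (fun z : EuclideanSpace ℂ (Fin n) =>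
      (f (e.symm (1, z)))⁻¹ • e.symm (1, z)) (affineCoord e x) :=
    (h₁.contDiffAt.inv hx').smul h₂.contDiffAt
  have hU := (isOpen_affineDomain e).mem_nhds (mem_frameAt x)
  refine (h₃.contMDiffAt.comp x ((contMDiffOn_affineCoord e).contMDiffAt hU)).congr_of_eventuallyEq
    ?_
  filter_upwards [hU] with y hy
  conv_lhs => rw [← hc y hy]
  exact normalizedRep_mk f _ _

end NormalizedRep

/-! ### The determinant on a plane -/

section AreaForm

/-- The alternating form `(z, w) ↦ z₀ w₁ - z₁ w₀` on `ℂ²`, in linear coordinates on a plane. -/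
def areaForm {W : Type*} [NormedAddCommGroup W] [NormedSpace ℂ W] (b : W ≃L[ℂ] ℂ × ℂ) :
    W →L[ℂ] W →L[ℂ] ℂ :=
  let p : W →L[ℂ] ℂ := (ContinuousLinearMap.fst ℂ ℂ ℂ).comp (b : W →L[ℂ] ℂ × ℂ)
  let q : W →L[ℂ] ℂ := (ContinuousLinearMap.snd ℂ ℂ ℂ).comp (b : W →L[ℂ] ℂ × ℂ)
  p.smulRight q - q.smulRight p

variable {W : Type*} [NormedAddCommGroup W] [NormedSpace ℂ W] (b : W ≃L[ℂ] ℂ × ℂ)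

theorem areaForm_apply (w t : W) :
    areaForm b w t = (b w).1 * (b t).2 - (b w).2 * (b t).1 := rfl

/-- A vanishing 2 × 2 determinant means proportional vectors; the factor is read off a nonzero
coordinate of `t`. This yields injectivity of `W/ℓ → ℓ^∨`. -/
theorem areaForm_eq_zero_iff {w t : W} (ht : t ≠ 0) :
    areaForm b w t = 0 ↔ ∃ a : ℂ, a • t = w := by
  rw [areaForm_apply]
  constructor
  · intro h
    by_cases h₁ : (b t).1 = 0
    · have h₂ : (b t).2 ≠ 0 := fun h₂ => ht (b.injective (by
        rw [map_zero]
        exact Prod.ext h₁ h₂))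
      refine ⟨(b w).2 / (b t).2, b.injective (Prod.ext ?_ ?_)⟩
      · have : (b w).1 = 0 := by simpa [h₁, h₂] using h
        simp [h₁, this]
      · simp [h₂]
    · refine ⟨(b w).1 / (b t).1, b.injective (Prod.ext ?_ ?_)⟩
      · simp [h₁]
      · simp only [map_smul, Prod.smul_snd, smul_eq_mul]
        field_simp
        linear_combination h
  · rintro ⟨a, rfl⟩
    simp only [map_smul, Prod.smul_fst, Prod.smul_snd, smul_eq_mul]
    ring

/-- For `t ≠ 0` the functional `det(·, t)` is nonzero, hence onto `ℂ`; a preimage is found on a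
single coordinate axis. This yields surjectivity of `W/ℓ → ℓ^∨`. -/
theorem exists_areaForm_eq {t : W} (ht : t ≠ 0) (c : ℂ) : ∃ w, areaForm b w t = c := by
  simp only [areaForm_apply]
  by_cases h₁ : (b t).1 = 0
  · have h₂ : (b t).2 ≠ 0 := fun h₂ => ht (b.injective (by
      rw [map_zero]
      exact Prod.ext h₁ h₂))
    exact ⟨b.symm (c / (b t).2, 0), by simp [h₂]⟩
  · exact ⟨b.symm (0, -c / (b t).1), by simp [h₁]⟩

end AreaForm

/-! ### The isomorphism on fibres and its matrix -/

section FibreMap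

variable {V : Type*} [NormedAddCommGroup V] [NormedSpace ℂ V] {W : Submodule ℂ V}
  {G : Type*} [NormedAddCommGroup G] [NormedSpace ℂ G]

theorem map_subtype_submodule (x : ℙ ℂ W) :
    (Projectivization.map W.subtype W.injective_subtype x).submodule =
      x.submodule.map W.subtype := by
  induction x with
  | h v hv =>
    rw [Projectivization.map_mk, Projectivization.submodule_mk, Projectivization.submodule_mk,
      Submodule.map_span, image_singleton]

/-- The linear map `v ↦ (t ↦ det (v', t), v'')` from `V` to the fibre at `x` of
`𝓞(1) ⊕ G`, in terms of a splitting `v ↦ (v', v'')` of `V` as `W × G`. -/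
def splitFibreMap (b : W ≃L[ℂ] ℂ × ℂ) (ψ : V ≃L[ℂ] W × G) (x : ℙ ℂ W) :
    V →ₗ[ℂ] HyperplaneBundle x × G where
  toFun v := ((areaForm b (ψ v).1).comp (TautologicalBundle.incl x), (ψ v).2)
  map_add' v w := by simp
  map_smul' a v := by simp

variable (b : W ≃L[ℂ] ℂ × ℂ) (ψ : V ≃L[ℂ] W × G)

/-- Vanishing of the first component means `v' ∈ ℓ`, and of the second `v'' = 0`. The condition `hψ`
says that `ψ` is the standard inclusion on `W`, so together these say that `v` lies in the image of
`ℓ`. -/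
theorem splitFibreMap_eq_zero_iff (hψ : ∀ w : W, ψ w = (w, 0)) (x : ℙ ℂ W) (v : V) :
    splitFibreMap b ψ x v = 0 ↔
      v ∈ (Projectivization.map W.subtype W.injective_subtype x).submodule := by
  -- A functional on the line vanishes if and only if it vanishes at the generator `x.rep`.
  have key : splitFibreMap b ψ x v = 0 ↔ areaForm b (ψ v).1 x.rep = 0 ∧ (ψ v).2 = 0 := by
    rw [Prod.ext_iff]
    refine and_congr ⟨fun h => ?_, fun h => ?_⟩ Iff.rfl
    · exact DFunLike.congr_fun h
        (⟨x.rep, (mem_submodule_iff x _).2 ⟨1, one_smul _ _⟩⟩ : x.submodule)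
    · ext t
      obtain ⟨a, ha⟩ := (mem_submodule_iff x (TautologicalBundle.incl x t)).1 t.2
      change areaForm b (ψ v).1 (TautologicalBundle.incl x t) = 0
      rw [← ha, map_smul, h, smul_zero]
  rw [key, areaForm_eq_zero_iff b x.rep_nonzero, ← mem_submodule_iff, map_subtype_submodule,
    Submodule.mem_map]
  constructor
  · rintro ⟨h₁, h₂⟩
    exact ⟨_, h₁, ψ.injective ((hψ _).trans (Prod.ext rfl h₂.symm))⟩
  · rintro ⟨w, hw, rfl⟩
    rw [W.subtype_apply, hψ]
    exact ⟨hw, rfl⟩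

/-- It suffices to match `g` at the generator `x.rep`, which the determinant can do; the
`G`-component is free. -/
theorem splitFibreMap_surjective (x : ℙ ℂ W) : Function.Surjective (splitFibreMap b ψ x) := by
  rintro ⟨g, u⟩
  obtain ⟨w, hw⟩ := exists_areaForm_eq b x.rep_nonzero
    (g (⟨x.rep, (mem_submodule_iff x _).2 ⟨1, one_smul _ _⟩⟩ : x.submodule))
  refine ⟨ψ.symm (w, u), Prod.ext ?_ ?_⟩
  · ext t
    obtain ⟨a, ha⟩ := (mem_submodule_iff x (TautologicalBundle.incl x t)).1 t.2
    have ht : t = a • (⟨x.rep, (mem_submodule_iff x _).2 ⟨1, one_smul _ _⟩⟩ : x.submodule) :=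
      Subtype.val_injective ha.symm
    change areaForm b (ψ (ψ.symm (w, u))).1 (TautologicalBundle.incl x t) = g t
    rw [← ha, map_smul, ψ.apply_symm_apply, hw, ht]
    exact (g.map_smul a _).symm
  · change (ψ (ψ.symm (w, u))).2 = u
    rw [ψ.apply_symm_apply]

/-- The linear isomorphism of the fibres of `Q` and `𝓞(1) ⊕ G` at a point of `ℙ(W)`. -/
def splitFibreEquiv (hψ : ∀ w : W, ψ w = (w, 0)) (x : ℙ ℂ W) :
    QuotientBundle (Projectivization.map W.subtype W.injective_subtype x) ≃ₗ[ℂ]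
      HyperplaneBundle x × G :=
  LinearEquiv.ofBijective
    (Submodule.liftQ _ (splitFibreMap b ψ x)
      fun v hv => (splitFibreMap_eq_zero_iff b ψ hψ x v).2 hv) (by
    constructor
    · refine (injective_iff_map_eq_zero _).2 fun q hq => ?_
      obtain ⟨v, rfl⟩ := QuotientBundle.proj_surjective _ q
      exact (QuotientBundle.proj_eq_zero _ v).2 ((splitFibreMap_eq_zero_iff b ψ hψ x v).1 hq)
    · intro y
      obtain ⟨v, rfl⟩ := splitFibreMap_surjective b ψ x y
      exact ⟨QuotientBundle.proj _ v, rfl⟩)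

/-- The matrix of `splitFibreEquiv` in the trivializations given by linear coordinates `e` on `V`
and a linear form on `W`, as a function of the normalized representative `s` of a point. -/
def splitCoord {E : Type*} [NormedAddCommGroup E] [NormedSpace ℂ E] (e : V ≃L[ℂ] ℂ × E) (s : W) :
    E →L[ℂ] (ℂ →L[ℂ] ℂ) × G :=
  -- The vector `e.symm (0, z)` lifts to `V` the class with coordinate `z`, by `quotCoordInv`.
  let j : E →L[ℂ] W × G := (ψ : V →L[ℂ] W × G).comp
    ((e.symm : ℂ × E →L[ℂ] V).comp (ContinuousLinearMap.inr ℂ ℂ E))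
  (ContinuousLinearMap.inl ℂ (ℂ →L[ℂ] ℂ) G).comp
      ((ContinuousLinearMap.toSpanSingletonCLE (𝕜 := ℂ) (E := ℂ) : ℂ →L[ℂ] ℂ →L[ℂ] ℂ).comp
        (((areaForm b).flip s).comp ((ContinuousLinearMap.fst ℂ W G).comp j))) +
    (ContinuousLinearMap.inr ℂ (ℂ →L[ℂ] ℂ) G).comp ((ContinuousLinearMap.snd ℂ W G).comp j)

/-- The vector `s` enters only as the second argument of a bilinear form, so the matrix is affine in
`s`. -/
theorem contDiff_splitCoord {E : Type*} [NormedAddCommGroup E] [NormedSpace ℂ E]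
    (e : V ≃L[ℂ] ℂ × E) : ContDiff ℂ ω (splitCoord b ψ e) := by
  unfold splitCoord
  fun_prop

theorem splitCoord_apply {E : Type*} [NormedAddCommGroup E] [NormedSpace ℂ E]
    (e : V ≃L[ℂ] ℂ × E) (s : W) (z : E) :
    splitCoord b ψ e s z = (ContinuousLinearMap.toSpanSingleton ℂ
      (areaForm b (ψ (e.symm (0, z))).1 s), (ψ (e.symm (0, z))).2) := by
  simp [splitCoord]
  rfl

end FibreMap

/-! ### Local coordinates on the hyperplane bundle -/

section Trivializations

variable {V : Type*} [NormedAddCommGroup V] [NormedSpace ℂ V]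

/-- A Hom bundle is trivialized by conjugating with the trivializations of source and target. Here
the target is trivial, so only precomposition with the inverse tautological coordinate remains. -/
theorem hyperplaneBundle_trivializationAt (x₀ : ℙ ℂ V) {x : ℙ ℂ V}
    (hx : x ∈ formDomain (formAt x₀)) (g : HyperplaneBundle x) :
    (trivializationAt (ℂ →L[ℂ] ℂ) (HyperplaneBundle (V := V)) x₀ ⟨x, g⟩).2 =
      g.comp (tautCoordInv (formAt x₀) x) := by
  rw [hom_trivializationAt_apply]
  change ContinuousLinearMap.inCoordinates ℂ TautologicalBundle ℂ (Bundle.Trivial (ℙ ℂ V) ℂ)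
    x₀ x x₀ x g = _
  rw [ContinuousLinearMap.inCoordinates_eq (ϕ := g) hx (mem_univ _)]
  ext
  exact congrArg g (tautPretriv_symm (formAt x₀) hx 1)

theorem incl_tautCoordInv_eq_smul_normalizedRep (f : V →L[ℂ] ℂ) (x : ℙ ℂ V) (c : ℂ) :
    TautologicalBundle.incl x (tautCoordInv f x c) = c • normalizedRep f x := by
  rw [incl_tautCoordInv, normalizedRep, smul_smul, mul_comm]

end Trivializations

/-! ### Splitting off the line and assembling the isomorphism -/

/-- A splitting of `V` as the direct sum of a subspace `W` and a coordinate space. -/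
theorem exists_splitting {V : Type*} [NormedAddCommGroup V] [NormedSpace ℂ V]
    [FiniteDimensional ℂ V] (W : Submodule ℂ V) {m : ℕ} (hm : finrank ℂ V = finrank ℂ W + m) :
    ∃ ψ : V ≃L[ℂ] W × (Fin m → ℂ), ∀ w : W, ψ w = (w, 0) := by
  obtain ⟨C, hC⟩ := W.exists_isCompl
  have hCm : finrank ℂ C = finrank ℂ (Fin m → ℂ) := by
    have := Submodule.finrank_add_eq_of_isCompl hC
    rw [finrank_fin_fun]
    omega
  let θ : V ≃ₗ[ℂ] W × (Fin m → ℂ) := (W.prodEquivOfIsCompl C hC).symm ≪≫ₗ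
    LinearEquiv.prodCongr (LinearEquiv.refl ℂ W) (LinearEquiv.ofFinrankEq C (Fin m → ℂ) hCm)
  refine ⟨θ.toContinuousLinearEquiv, fun w => ?_⟩
  change θ w = _
  simp [θ]

theorem nonempty_quotientBundle_iso {N : ℕ} {V : Type*} [NormedAddCommGroup V] [NormedSpace ℂ V]
    [Fact (finrank ℂ V = N + 1)] (W : Submodule ℂ V) [Fact (finrank ℂ W = 1 + 1)]
    {G : Type*} [NormedAddCommGroup G] [NormedSpace ℂ G] (b : W ≃L[ℂ] ℂ × ℂ)
    (ψ : V ≃L[ℂ] W × G) (hψ : ∀ w : W, ψ w = (w, 0)) :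
    Nonempty (HolomorphicBundleIso (B := ℙ ℂ W) 𝓘(ℂ, EuclideanSpace ℂ (Fin 1))
      (EuclideanSpace ℂ (Fin N)) (linearInclusion (N := N) (k := 1) W *ᵖ QuotientBundle)
      ((ℂ →L[ℂ] ℂ) × G) (HyperplaneBundle ×ᵇ Bundle.Trivial (ℙ ℂ W) G)) := by
  let ι := linearInclusion (N := N) (k := 1) W
  refine nonempty_holomorphicBundleIso (splitFibreEquiv b ψ hψ)
    (fun x₀ x => splitCoord b ψ (frameAt (n := N) (ι x₀)) (normalizedRep (formAt x₀) x)) ?_ ?_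
  · intro x₀
    exact (contDiff_splitCoord b ψ _).contMDiff.contMDiffAt.comp x₀
      (contMDiffAt_normalizedRep (n := 1) (formAt x₀) (mem_formAt x₀))
  · intro x₀
    have hι : ContinuousAt ι x₀ := ι.contMDiff.continuous.continuousAt
    filter_upwards [(isOpen_formDomain (formAt x₀)).mem_nhds (mem_formAt x₀),
      hι.preimage_mem_nhds ((isOpen_affineDomain _).mem_nhds (mem_frameAt (n := N) (ι x₀)))]
      with x hx hx' q
    let e := frameAt (n := N) (ι x₀)
    -- Passing from `q` to its coordinate `z` provides the explicit lift `e.symm (0, z)`, on which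
    -- `splitFibreEquiv` can be evaluated.
    obtain ⟨z, rfl⟩ : ∃ z, quotCoordInv e (ι x) z = q :=
      ⟨quotCoord e (ι x) q, quotCoordInv_quotCoord e hx' q⟩
    have h₁ : (trivializationAt (EuclideanSpace ℂ (Fin N)) (ι *ᵖ QuotientBundle) x₀
        ⟨x, quotCoordInv e (ι x) z⟩).2 = z := quotCoord_quotCoordInv e hx' z
    refine Eq.trans ?_ (congrArg _ h₁.symm)
    rw [splitCoord_apply]
    -- The trivial summand is its own coordinate; only the `𝓞(1)` component needs an argument.
    refine Prod.ext ?_ rfl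
    refine (hyperplaneBundle_trivializationAt x₀ hx _).trans ?_
    -- Linear maps `ℂ → ℂ` are compared at `1`, which the inverse tautological coordinate sends to
    -- the normalized representative.
    ext
    change areaForm b _ (TautologicalBundle.incl x (tautCoordInv (formAt x₀) x 1)) = _
    rw [incl_tautCoordInv_eq_smul_normalizedRep, one_smul]
    exact (one_smul ℂ _).symm

end HoloProj

end

theorem lemma6p1 (N : ℕ) (V : Type*) [NormedAddCommGroup V] [NormedSpace ℂ V]
    [Fact (Module.finrank ℂ V = N + 1)]
    (W : Submodule ℂ V) [Fact (Module.finrank ℂ W = 2)] :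
    Nonempty (HoloProj.HolomorphicBundleIso (B := ℙ ℂ W) 𝓘(ℂ, EuclideanSpace ℂ (Fin 1))
      (EuclideanSpace ℂ (Fin N))
      (HoloProj.linearInclusion (N := N) (k := 1) W *ᵖ HoloProj.QuotientBundle)
      ((ℂ →L[ℂ] ℂ) × (Fin (N - 1) → ℂ))
      (HoloProj.HyperplaneBundle ×ᵇ Bundle.Trivial (ℙ ℂ W) (Fin (N - 1) → ℂ))) := by
  have hV : Module.finrank ℂ V = N + 1 := Fact.out
  have hW : Module.finrank ℂ W = 2 := Fact.out
  have : FiniteDimensional ℂ V := FiniteDimensional.of_finrank_pos (by omega)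
  -- This gives `2 ≤ N + 1`, so the truncated difference `N - 1` is the true codimension of `W`.
  have hle := Submodule.finrank_le W
  obtain ⟨ψ, hψ⟩ := HoloProj.exists_splitting W (m := N - 1) (by omega)
  exact HoloProj.nonempty_quotientBundle_iso W
    (ContinuousLinearEquiv.ofFinrankEq (by rw [hW]; simp)) ψ hψ
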